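/- There is a universal constant $C>0$ such that the following holds. Let $M$ be a matroid on a finite ground set $E$ with $n=|E|$, let $r=r(M)$ be its rank and let $\mathcal F$ be its set of bases. The bases-exchange walk on $\mathcal F$ is the Markov chain which moves from a basis $B_t$ as follows: choose $e\in B_t$ uniformly at random; then choose $f$ uniformly at random from the set of all $f\in E$ for which $(B_t\setminus\{e\})\cup\{f\}$ is a basis of $M$; and set $B_{t+1}=(B_t\setminus\{e\})\cup\{f\}$. (If $r=0$, the chain stays at the only basis $\emptyset$.) Its stationary distribution is the uniform distribution $\pi$ on $\mathcal F$. Let $T_{\mathrm{mix}}$ be its mixing time, that is, the minimum number $t\ge 0$ of steps such that, for every initial basis $B_0$, the distribution of $B_t$ is within total variation distance at most $1/4$ of $\pi$. Then $T_{\mathrm{mix}}$ is finite and $$T_{\mathrm{mix}}\;\le\; C\, r\log|\mathcal F|\;\le\; C\, r^2\log n ,$$ where, for $n=0$ (so that $r=0$), the right-hand side is read as $0$. -/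

import Mathlib

namespace BasesExchange

/-- The set of bases of a matroid on a finite type, as finsets: the state space of the walk. -/
abbrev Bases {α : Type*} (M : Matroid α) : Type _ :=
  {B : Finset α // M.IsBase (B : Set α)}

noncomputable instance {α : Type*} [Fintype α] (M : Matroid α) : Fintype (Bases M) :=
  Fintype.ofFinite _

/-- The rank of a matroid on a finite type: the common cardinality of its bases. -/
noncomputable def rk {α : Type*} (M : Matroid α) : ℕ := M.eRank.toNat

open Classical in
/-- For `S = B \ {e}`, with `B` a basis and `e ∈ B`: the set of all elements `f` for which
`S ∪ {f}` is again a basis, i.e. the elements that can be added to `S` (so `f ∉ S`) while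
remaining independent. It contains `e`. -/
noncomputable def extensions {α : Type*} [Fintype α] [DecidableEq α] (M : Matroid α)
    (S : Finset α) : Finset α :=
  {f | M.IsBase ((insert f S : Finset α) : Set α)}

/-- The transition matrix of the bases-exchange walk. From a basis `B`, choose `e ∈ B` uniformly
at random, then choose `f` uniformly at random among the elements for which `(B \ {e}) ∪ {f}` is a
basis, and move to `(B \ {e}) ∪ {f}`. The entry at `(B, B')` is the probability of moving
to `B'`. If the matroid has rank zero, the only state is the empty basis and the walk stays. -/
noncomputable def walk {α : Type*} [Fintype α] [DecidableEq α] (M : Matroid α) :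
    Matrix (Bases M) (Bases M) ℝ := fun B B' =>
  if B.1 = ∅ then (if B' = B then 1 else 0) else
    ∑ e ∈ B.1, (1 / (B.1.card : ℝ)) *
      ∑ f ∈ extensions M (B.1.erase e),
        (1 / ((extensions M (B.1.erase e)).card : ℝ)) *
          (if B'.1 = insert f (B.1.erase e) then 1 else 0)

/-- Total variation distance of two probability vectors on a finite set. -/
noncomputable def tvDist {Ω : Type*} [Fintype Ω] (μ ν : Ω → ℝ) : ℝ :=
  (1 / 2) * ∑ x, |μ x - ν x|

/-- The uniform distribution on a finite set. -/
noncomputable def uniform (Ω : Type*) [Fintype Ω] : Ω → ℝ :=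
  fun _ => 1 / (Fintype.card Ω : ℝ)

/-- `T` is the mixing time `T_mix(ε)` of the chain with transition matrix `P` and stationary
distribution `π`: the minimum number `t` of steps such that, from every (hence from the worst)
initial state `x`, the distribution `P ^ t (x, ·)` of the chain after `t` steps is within total
variation distance `ε` of `π`. In particular such a `t` exists. -/
def IsMixingTime {Ω : Type*} [Fintype Ω] [DecidableEq Ω] (P : Matrix Ω Ω ℝ) (π : Ω → ℝ)
    (ε : ℝ) (T : ℕ) : Prop :=
  IsLeast {t : ℕ | ∀ x : Ω, tvDist ((P ^ t) x) π ≤ ε} T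

theorem mem_extensions {α : Type*} [Fintype α] [DecidableEq α] (M : Matroid α)
    (S : Finset α) (f : α) :
    f ∈ extensions M S ↔ M.IsBase ((insert f S : Finset α) : Set α) := by
  simp [extensions]

theorem bases_card {α : Type*} (M : Matroid α) (B : Bases M) : B.1.card = rk M := by
  rw [rk, ← B.2.encard_eq_eRank, Set.encard_coe_eq_coe_finsetCard]
  rfl

theorem walk_nonneg {α : Type*} [Fintype α] [DecidableEq α] (M : Matroid α) (B B' : Bases M) :
    0 ≤ walk M B B' := by
  unfold walk
  split_ifs <;> positivity

/-- The rows of the transition matrix are probability vectors. -/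
theorem walk_row_sum {α : Type*} [Fintype α] [DecidableEq α] (M : Matroid α) (B : Bases M) :
    ∑ B', walk M B B' = 1 := by
  by_cases hB : B.1 = ∅
  · simp [walk, hB]
  · simp only [walk, hB, if_false]
    rw [Finset.sum_comm]
    have key : ∀ e ∈ B.1, ∑ B' : Bases M, (1 / (B.1.card : ℝ)) *
        ∑ f ∈ extensions M (B.1.erase e),
          (1 / ((extensions M (B.1.erase e)).card : ℝ)) *
            (if B'.1 = insert f (B.1.erase e) then 1 else 0) = 1 / (B.1.card : ℝ) := by
      intro e he
      rw [← Finset.mul_sum, Finset.sum_comm]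
      have h1 : ∀ f ∈ extensions M (B.1.erase e), ∑ B' : Bases M,
          (1 / ((extensions M (B.1.erase e)).card : ℝ)) *
            (if B'.1 = insert f (B.1.erase e) then 1 else 0)
          = 1 / ((extensions M (B.1.erase e)).card : ℝ) := by
        intro f hf
        rw [← Finset.mul_sum,
          Finset.sum_eq_single (⟨_, (mem_extensions M _ f).1 hf⟩ : Bases M)]
        · simp
        · intro b _ hb
          rw [if_neg]
          intro h
          exact hb (Subtype.ext h)
        · simp
      rw [Finset.sum_congr rfl h1]
      have hne : ((extensions M (B.1.erase e)).card : ℝ) ≠ 0 := by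
        have : e ∈ extensions M (B.1.erase e) := by
          rw [mem_extensions, Finset.insert_erase he]; exact B.2
        exact_mod_cast (Finset.card_pos.2 ⟨e, this⟩).ne'
      simp [hne]
    rw [Finset.sum_congr rfl key]
    have hne : (B.1.card : ℝ) ≠ 0 := by
      exact_mod_cast (Finset.card_pos.2 (Finset.nonempty_iff_ne_empty.2 hB)).ne'
    simp [hne]

/-- The walk is symmetric. -/
theorem walk_symm {α : Type*} [Fintype α] [DecidableEq α] (M : Matroid α) (B B' : Bases M) :
    walk M B B' = walk M B' B := by
  have hc : B.1.card = B'.1.card := (bases_card M B).trans (bases_card M B').symm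
  by_cases hB : B.1 = ∅
  · have hB' : B'.1 = ∅ := by
      rw [hB, Finset.card_empty] at hc
      exact Finset.card_eq_zero.1 hc.symm
    have : B = B' := Subtype.ext (hB.trans hB'.symm)
    rw [this]
  by_cases hBB : B = B'
  · rw [hBB]
  -- off the diagonal, a transition removes an `e` with `B \ {e} ⊆ B'`
  have form : ∀ X Y : Bases M, X.1 ≠ ∅ → X ≠ Y → X.1.card = Y.1.card →
      walk M X Y = (1 / (X.1.card : ℝ)) * ∑ S : Finset α,
        if S ⊆ X.1 ∧ S ⊆ Y.1 ∧ S.card + 1 = X.1.card then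
          1 / ((extensions M S).card : ℝ) else 0 := by
    intro X Y hX hXY hcard
    simp only [walk, hX, if_false]
    rw [← Finset.mul_sum]
    congr 1
    have inner : ∀ e ∈ X.1, ∑ f ∈ extensions M (X.1.erase e),
        (1 / ((extensions M (X.1.erase e)).card : ℝ)) *
          (if Y.1 = insert f (X.1.erase e) then 1 else 0) =
        if X.1.erase e ⊆ Y.1 then 1 / ((extensions M (X.1.erase e)).card : ℝ) else 0 := by
      intro e he
      have hce : (X.1.erase e).card + 1 = X.1.card := Finset.card_erase_add_one he
      split_ifs with hs
      · have hd : (Y.1 \ X.1.erase e).card = 1 := by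
          rw [Finset.card_sdiff_of_subset hs]; omega
        obtain ⟨g, hg⟩ := Finset.card_eq_one.1 hd
        have hY : Y.1 = insert g (X.1.erase e) := by
          rw [← Finset.sdiff_union_of_subset hs, hg]; rfl
        have hgm : g ∉ X.1.erase e := by
          have : g ∈ Y.1 \ X.1.erase e := by rw [hg]; simp
          exact (Finset.mem_sdiff.1 this).2
        rw [Finset.sum_eq_single g]
        · simp [← hY]
        · intro f _ hfg
          rw [if_neg, mul_zero]
          intro h
          have : g ∈ insert f (X.1.erase e) := by rw [← h, hY]; simp
          rcases Finset.mem_insert.1 this with h | h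
          · exact hfg h.symm
          · exact hgm h
        · intro h
          exact absurd ((mem_extensions M _ g).2 (by rw [← hY]; exact Y.2)) h
      · refine Finset.sum_eq_zero fun f _ => ?_
        rw [if_neg, mul_zero]
        intro h
        exact hs (by rw [h]; exact Finset.subset_insert _ _)
    rw [Finset.sum_congr rfl inner, ← Finset.sum_filter, ← Finset.sum_filter]
    refine Finset.sum_bij (fun e _ => X.1.erase e) ?_ ?_ ?_ ?_
    · intro e he
      simp only [Finset.mem_filter] at he
      simp only [Finset.mem_filter, Finset.mem_univ, true_and]
      exact ⟨Finset.erase_subset _ _, he.2, Finset.card_erase_add_one he.1⟩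
    · intro a ha b hb h
      simp only [Finset.mem_filter] at ha hb
      by_contra hab
      have : a ∈ X.1.erase b := Finset.mem_erase.2 ⟨hab, ha.1⟩
      rw [← h] at this
      simp at this
    · intro S hS
      simp only [Finset.mem_filter, Finset.mem_univ, true_and] at hS
      obtain ⟨h1, h2, h3⟩ := hS
      have hd : (X.1 \ S).card = 1 := by
        rw [Finset.card_sdiff_of_subset h1]; omega
      obtain ⟨g, hg⟩ := Finset.card_eq_one.1 hd
      have hgX : g ∈ X.1 \ S := by rw [hg]; simp
      have hSe : X.1.erase g = S := by
        rw [← Finset.sdiff_singleton_eq_erase, ← hg, Finset.sdiff_sdiff_eq_self h1]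
      refine ⟨g, ?_, hSe⟩
      simp only [Finset.mem_filter]
      exact ⟨(Finset.mem_sdiff.1 hgX).1, by rw [hSe]; exact h2⟩
    · intro a _
      rfl
  have hB' : B'.1 ≠ ∅ := by
    intro h
    rw [h, Finset.card_empty] at hc
    exact hB (Finset.card_eq_zero.1 hc)
  rw [form B B' hB hBB hc, form B' B hB' (Ne.symm hBB) hc.symm, hc]
  congr 1
  refine Finset.sum_congr rfl fun S _ => ?_
  congr 1
  exact propext ⟨fun h => ⟨h.2.1, h.1, h.2.2⟩, fun h => ⟨h.2.1, h.1, h.2.2⟩⟩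

/-- The uniform distribution on the bases is stationary for the walk. -/
theorem uniform_stationary {α : Type*} [Fintype α] [DecidableEq α] (M : Matroid α) :
    Matrix.vecMul (uniform (Bases M)) (walk M) = uniform (Bases M) := by
  funext B
  simp only [Matrix.vecMul, dotProduct, uniform]
  rw [← Finset.mul_sum, Finset.sum_congr rfl (fun B' _ => walk_symm M B' B), walk_row_sum,
    mul_one]

end BasesExchange

/-! The walk drops a uniform element of `B` and then resamples uniformly among the bases containing
the remaining facet `T`, so `P f (B)` is the average of the means of `f` above the facets of `B`.
Hence `r * ⟨f, P f⟩` is a weighted sum of squares of these means, which makes `P` positive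
semidefinite, and a spectral gap of `1 / r` is the Poincaré inequality: the variance of `f` is at
most the sum of its unnormalized variances above all facets (`varianceAbove_le_sum_facetsAbove`).

The Poincaré inequality is proved one element at a time (`mul_varianceAbove_le_sum_insert`). Each
step needs one spectral fact, `quadForm_nonpos`: for every `S` of corank at least 2, the matrix
counting the bases that contain `S`, `e` and `f`, with zero diagonal, is negative semidefinite on
the hyperplane `linearForm M S g = 0`. This goes by induction on the corank. In corank 2 the matrix
is the adjacency matrix of a complete multipartite graph, whose parts are the parallel classes over
`S`. In higher corank Oppenheim's trickle-down argument (`quadraticForm_nonpos_of_trickle_down`)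
passes from all the `S ∪ {h}` to `S`, using that the graph of independent pairs over `S` is
connected.

Finally the gap contracts mean-zero functions in `ℓ²`, and Cauchy-Schwarz gives distance at most
`√|F| / 2 * exp (-t / r)` after `t` steps, `F` being the set of bases. The second inequality is `|F|
≤ n ^ r`. -/

namespace BasesExchange

open Finset

/-! ### Trickle-down for weighted graphs. -/

/-- A symmetric nonnegative weight `H` with row sums `c * w`, whose graph is connected on the
support of `w` and which satisfies the local inequality `c * gᵀHg ≤ ∑ (Hg)² / w`, is negative
semidefinite on the functions of `w`-mean zero. -/
theorem quadraticForm_nonpos_of_trickle_down {ι : Type*} [Fintype ι] [DecidableEq ι]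
    (H : Matrix ι ι ℝ) (w : ι → ℝ) (c : ℝ)
    (hH : ∀ e f, 0 ≤ H e f) (hsymm : ∀ e f, H e f = H f e) (hw : ∀ e, 0 ≤ w e)
    (hrow : ∀ e, ∑ f, H e f = c * w e)
    (hloc : ∀ g : ι → ℝ, c * ∑ e, g e * ∑ f, H e f * g f ≤ ∑ e, (∑ f, H e f * g f) ^ 2 / w e)
    (hconn : ∀ g : ι → ℝ, (∀ e f, 0 < H e f → g e = g f) →
      ∀ e f, 0 < w e → 0 < w f → g e = g f)
    (g : ι → ℝ) (hg : ∑ e, w e * g e = 0) :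
    ∑ e, g e * ∑ f, H e f * g f ≤ 0 := by
  have hH0 : ∀ e f, w e = 0 → H e f = 0 := by
    intro e f he
    have h := hrow e
    rw [he, mul_zero, Finset.sum_eq_zero_iff_of_nonneg (fun f _ => hH e f)] at h
    exact h f (mem_univ f)
  have hpos : ∀ e, w e ≠ 0 → 0 < √(w e) := fun e he =>
    Real.sqrt_pos.2 (lt_of_le_of_ne (hw e) (Ne.symm he))
  have hcancel : ∀ e f, H e f / (√(w e) * √(w f)) * √(w e) * √(w f) = H e f := by
    intro e f
    by_cases he : w e = 0
    · simp [hH0 e f he]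
    by_cases hf : w f = 0
    · simp [hsymm e f, hH0 f e hf]
    have := hpos e he
    have := hpos f hf
    field_simp
  -- Normalized adjacency matrix; division by zero makes it vanish off the support of `w`, as `H`
  -- does.
  set A : Matrix ι ι ℝ := Matrix.of fun e f => H e f / (√(w e) * √(w f)) with hA
  have hherm : A.IsHermitian := by
    ext e f
    simp [hA, hsymm f e, mul_comm (√(w f))]
  set v := hherm.eigenvectorBasis with hv
  set μ := hherm.eigenvalues with hμ
  have heig : ∀ i e, ∑ f, A e f * v i f = μ i * v i e := by
    intro i e
    have h := congrFun (hherm.mulVec_eigenvectorBasis i) e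
    simpa [Matrix.mulVec, dotProduct] using h
  set y : EuclideanSpace ℝ ι := WithLp.toLp 2 fun e => √(w e) * g e with hy
  -- an eigenvector for a positive eigenvalue is proportional to `√w`
  have horth : ∀ i, 0 < μ i → inner ℝ (v i) y = 0 := by
    intro i hi
    set x : ι → ℝ := fun e => v i e / √(w e) with hx
    have hv0 : ∀ e, w e = 0 → v i e = 0 := by
      intro e he
      have h := heig i e
      have : ∑ f, A e f * v i f = 0 := by simp [hA, he]
      rw [this] at h
      exact (mul_eq_zero.1 h.symm).resolve_left hi.ne'
    have hxv : ∀ e, v i e = √(w e) * x e := by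
      intro e
      by_cases he : w e = 0
      · simp [hv0 e he, he]
      · have := hpos e he
        simp only [hx]
        field_simp
    have hHx : ∀ e, ∑ f, H e f * x f = μ i * (w e * x e) := by
      intro e
      have h1 : ∑ f, H e f * x f = √(w e) * ∑ f, A e f * v i f := by
        rw [mul_sum]
        refine sum_congr rfl fun f _ => ?_
        rw [hxv f]
        conv_lhs => rw [← hcancel e f]
        simp only [hA, Matrix.of_apply]
        ring
      rw [h1, heig, hxv]
      have := Real.mul_self_sqrt (hw e)
      linear_combination μ i * x e * this
    have hnorm : ∑ e, w e * x e ^ 2 = 1 := by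
      have h1 : ‖v i‖ ^ 2 = 1 := by rw [v.norm_eq_one]; norm_num
      rw [EuclideanSpace.norm_sq_eq] at h1
      rw [← h1]
      refine sum_congr rfl fun e _ => ?_
      rw [Real.norm_eq_abs, sq_abs, hxv e, mul_pow, Real.sq_sqrt (hw e)]
    have hform : ∑ e, x e * ∑ f, H e f * x f = μ i := by
      rw [← mul_one (μ i), ← hnorm, mul_sum]
      refine sum_congr rfl fun e _ => ?_
      rw [hHx]; ring
    -- At `x` the local inequality reads `c * μ ≤ μ ^ 2`.
    have hcμ : c ≤ μ i := by
      have h := hloc x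
      rw [hform] at h
      have h2 : ∑ e, (∑ f, H e f * x f) ^ 2 / w e = μ i ^ 2 := by
        rw [← mul_one (μ i ^ 2), ← hnorm, mul_sum]
        refine sum_congr rfl fun e _ => ?_
        rw [hHx]
        by_cases he : w e = 0
        · simp [he]
        · field_simp
      rw [h2] at h
      nlinarith
    -- The Dirichlet form is nonnegative, which gives `μ ≤ c`. With `c ≤ μ` it vanishes, so `x` is
    -- constant along edges, hence on the support of `w`.
    have hsq : ∑ e, ∑ f, H e f * (x e - x f) ^ 2 = 2 * c - 2 * μ i := by
      have h1 : ∑ e, ∑ f, H e f * x e ^ 2 = c := by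
        rw [← mul_one c, ← hnorm, mul_sum]
        refine sum_congr rfl fun e _ => ?_
        rw [← sum_mul, hrow]; ring
      have h2 : ∑ e, ∑ f, H e f * x f ^ 2 = c := by
        rw [sum_comm, ← h1]
        refine sum_congr rfl fun e _ => sum_congr rfl fun f _ => ?_
        rw [hsymm]
      have h3 : ∑ e, ∑ f, H e f * (x e * x f) = μ i := by
        rw [← hform]
        refine sum_congr rfl fun e _ => ?_
        rw [mul_sum]
        refine sum_congr rfl fun f _ => ?_
        ring
      have h4 : ∀ e f, H e f * (x e - x f) ^ 2 =
          H e f * x e ^ 2 + H e f * x f ^ 2 - 2 * (H e f * (x e * x f)) := fun e f => by ring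
      simp only [h4, sum_sub_distrib, sum_add_distrib, ← mul_sum, h1, h2, h3]
      ring
    have hterm : ∀ e f, 0 ≤ H e f * (x e - x f) ^ 2 := fun e f =>
      mul_nonneg (hH e f) (sq_nonneg _)
    have hzero : ∑ e, ∑ f, H e f * (x e - x f) ^ 2 = 0 :=
      le_antisymm (by rw [hsq]; linarith)
        (sum_nonneg fun e _ => sum_nonneg fun f _ => hterm e f)
    have hxconst := hconn x (by
      intro e f hef
      rw [sum_eq_zero_iff_of_nonneg (fun e _ => sum_nonneg fun f _ => hterm e f)] at hzero
      have h := hzero e (mem_univ e)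
      rw [sum_eq_zero_iff_of_nonneg (fun f _ => hterm e f)] at h
      have h := (mul_eq_zero.1 (h f (mem_univ f))).resolve_left hef.ne'
      exact sub_eq_zero.1 (pow_eq_zero_iff two_ne_zero |>.1 h))
    have hinner : inner ℝ (v i) y = ∑ e, w e * g e * x e := by
      rw [PiLp.inner_apply]
      refine sum_congr rfl fun e _ => ?_
      have := Real.mul_self_sqrt (hw e)
      simp only [hy, RCLike.inner_apply, conj_trivial]
      rw [hxv e]
      linear_combination x e * g e * this
    rw [hinner]
    by_cases hall : ∀ e, w e = 0
    · simp [hall]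
    push Not at hall
    obtain ⟨a, ha⟩ := hall
    have : ∀ e, w e * g e * x e = w e * g e * x a := by
      intro e
      by_cases he : w e = 0
      · simp [he]
      · rw [hxconst e a (lt_of_le_of_ne (hw e) (Ne.symm he))
          (lt_of_le_of_ne (hw a) (Ne.symm ha))]
    rw [sum_congr rfl fun e _ => this e, ← sum_mul, hg, zero_mul]
  have hQ : ∑ e, g e * ∑ f, H e f * g f = inner ℝ y (Matrix.toEuclideanLin A y) := by
    rw [PiLp.inner_apply]
    refine sum_congr rfl fun e _ => ?_
    simp only [hy, RCLike.inner_apply, conj_trivial, Matrix.toLpLin_apply, Matrix.mulVec,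
      dotProduct]
    rw [mul_sum, sum_mul]
    refine sum_congr rfl fun f _ => ?_
    conv_lhs => rw [← hcancel e f]
    simp only [hA, Matrix.of_apply]
    ring
  rw [hQ, ← v.sum_inner_mul_inner]
  refine sum_nonpos fun i _ => ?_
  have hAy : inner ℝ (v i) (Matrix.toEuclideanLin A y) = μ i * inner ℝ (v i) y := by
    have hs := (Matrix.isSymmetric_toEuclideanLin_iff.2 hherm) (v i) y
    rw [← hs]
    have : Matrix.toEuclideanLin A (v i) = μ i • v i := by
      ext e
      simpa [Matrix.toLpLin_apply, Matrix.mulVec, dotProduct] using heig i e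
    rw [this, real_inner_smul_left]
  rw [hAy, real_inner_comm]
  by_cases hi : 0 < μ i
  · rw [horth i hi]; simp
  · nlinarith [mul_self_nonneg (inner ℝ (v i) y)]

/-! ### Linear and quadratic forms counting bases above a set. -/

variable {α : Type*} [Fintype α] [DecidableEq α] (M : Matroid α)

/-- The bases that contain `S`. -/
noncomputable def basesAbove (S : Finset α) : Finset (Bases M) := {B | S ⊆ B.1}

theorem mem_basesAbove {S : Finset α} {B : Bases M} : B ∈ basesAbove M S ↔ S ⊆ B.1 := by
  simp [basesAbove]

theorem basesAbove_nonempty_iff {S : Finset α} :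
    (basesAbove M S).Nonempty ↔ M.Indep (S : Set α) := by
  constructor
  · rintro ⟨B, hB⟩
    exact B.2.indep.subset (by exact_mod_cast (mem_basesAbove M).1 hB)
  · intro h
    obtain ⟨B, hB, hSB⟩ := h.exists_isBase_superset
    refine ⟨⟨B.toFinite.toFinset, by simpa using hB⟩, (mem_basesAbove M).2 ?_⟩
    intro e he
    simpa using hSB he

theorem card_basesAbove_pos_iff {S : Finset α} :
    (0 : ℝ) < #(basesAbove M S) ↔ M.Indep (S : Set α) := by
  rw [← basesAbove_nonempty_iff, ← card_pos, Nat.cast_pos]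

theorem sum_basesAbove_insert (S : Finset α) (φ : α → Bases M → ℝ) :
    ∑ e ∈ Sᶜ, ∑ B ∈ basesAbove M (insert e S), φ e B =
      ∑ B ∈ basesAbove M S, ∑ e ∈ B.1 \ S, φ e B := by
  refine sum_comm' fun e B => ?_
  simp only [mem_basesAbove, insert_subset_iff, mem_compl, mem_sdiff]
  tauto

variable {M} in
theorem card_sdiff_of_mem_basesAbove {S : Finset α} {m : ℕ} (hS : #S + m = rk M) {B : Bases M}
    (hB : B ∈ basesAbove M S) : #(B.1 \ S) = m := by
  rw [card_sdiff_of_subset ((mem_basesAbove M).1 hB), bases_card]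
  omega

variable {M} in
theorem sum_sdiff_insert {S : Finset α} {h : α} (hS : h ∉ S) {B : Bases M}
    (hB : B ∈ basesAbove M (insert h S)) (g : α → ℝ) :
    ∑ e ∈ B.1 \ insert h S, g e = ∑ e ∈ B.1 \ S, g e - g h := by
  have hh : h ∈ B.1 \ S := mem_sdiff.2 ⟨(mem_basesAbove M).1 hB (mem_insert_self h S), hS⟩
  rw [sdiff_insert, ← add_sum_erase _ _ hh, add_sub_cancel_left]

/-- The sum of `g` over the elements of the bases containing `S`, outside `S`. -/
noncomputable def linearForm (S : Finset α) (g : α → ℝ) : ℝ :=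
  ∑ B ∈ basesAbove M S, ∑ e ∈ B.1 \ S, g e

/-- The sum of `g e * g f` over the ordered pairs of distinct elements of the bases
containing `S`, outside `S`. -/
noncomputable def quadForm (S : Finset α) (g : α → ℝ) : ℝ :=
  ∑ B ∈ basesAbove M S, ((∑ e ∈ B.1 \ S, g e) ^ 2 - ∑ e ∈ B.1 \ S, g e ^ 2)

theorem linearForm_eq (S : Finset α) (g : α → ℝ) :
    linearForm M S g = ∑ e ∈ Sᶜ, #(basesAbove M (insert e S)) * g e := by
  rw [linearForm, ← sum_basesAbove_insert]
  simp

theorem quadForm_eq (S : Finset α) (g : α → ℝ) :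
    quadForm M S g = ∑ e ∈ Sᶜ, g e * linearForm M (insert e S) g := by
  have h : ∀ e ∈ Sᶜ, g e * linearForm M (insert e S) g =
      ∑ B ∈ basesAbove M (insert e S), g e * (∑ f ∈ B.1 \ S, g f - g e) := by
    intro e he
    rw [linearForm, mul_sum]
    refine sum_congr rfl fun B hB => ?_
    rw [sum_sdiff_insert (mem_compl.1 he) hB]
  rw [sum_congr rfl h, sum_basesAbove_insert, quadForm]
  refine sum_congr rfl fun B _ => ?_
  simp only [mul_sub, sum_sub_distrib, ← sum_mul, sq]

variable {M}

theorem linearForm_one {S : Finset α} {m : ℕ} (hS : #S + m = rk M) :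
    linearForm M S (fun _ => 1) = m * #(basesAbove M S) := by
  rw [linearForm, sum_congr rfl fun B hB => by
    rw [sum_const, card_sdiff_of_mem_basesAbove hS hB]]
  simp [mul_comm]

/-- A pair of distinct elements of `B \ S` survives the removal of `h` for exactly `m` of the `m +
2` choices of `h`. -/
theorem sum_quadForm_insert {S : Finset α} {m : ℕ} (hS : #S + (m + 2) = rk M) (g : α → ℝ) :
    ∑ h ∈ Sᶜ, quadForm M (insert h S) g = m * quadForm M S g := by
  have h1 : ∀ h ∈ Sᶜ, quadForm M (insert h S) g = ∑ B ∈ basesAbove M (insert h S),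
      ((∑ e ∈ B.1 \ S, g e - g h) ^ 2 - (∑ e ∈ B.1 \ S, g e ^ 2 - g h ^ 2)) := by
    intro h hh
    refine sum_congr rfl fun B hB => ?_
    rw [sum_sdiff_insert (mem_compl.1 hh) hB,
      sum_sdiff_insert (mem_compl.1 hh) hB (fun e => g e ^ 2)]
  rw [sum_congr rfl h1, sum_basesAbove_insert, quadForm, mul_sum]
  refine sum_congr rfl fun B hB => ?_
  have hc := card_sdiff_of_mem_basesAbove hS hB
  set σ := ∑ e ∈ B.1 \ S, g e with hσ
  set q := ∑ e ∈ B.1 \ S, g e ^ 2 with hq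
  have h2 : ∀ h, (σ - g h) ^ 2 - (q - g h ^ 2) = (σ ^ 2 - q) - 2 * σ * g h + 2 * g h ^ 2 :=
    fun h => by ring
  simp only [h2, sum_add_distrib, sum_sub_distrib, ← mul_sum, ← hσ, ← hq, sum_const, hc,
    nsmul_eq_mul]
  push_cast
  ring

theorem quadForm_sub_const {S : Finset α} {m : ℕ} (hS : #S + m = rk M) (g : α → ℝ) (t : ℝ) :
    quadForm M S (fun e => g e - t) =
      quadForm M S g - 2 * t * (m - 1) * linearForm M S g +
        t ^ 2 * (m * (m - 1)) * #(basesAbove M S) := by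
  have h : ∀ B ∈ basesAbove M S,
      (∑ e ∈ B.1 \ S, (g e - t)) ^ 2 - ∑ e ∈ B.1 \ S, (g e - t) ^ 2 =
        ((∑ e ∈ B.1 \ S, g e) ^ 2 - ∑ e ∈ B.1 \ S, g e ^ 2) -
          2 * t * (m - 1) * ∑ e ∈ B.1 \ S, g e + t ^ 2 * (m * (m - 1)) := by
    intro B hB
    have hc := card_sdiff_of_mem_basesAbove hS hB
    have h2 : ∀ e, (g e - t) ^ 2 = g e ^ 2 - 2 * t * g e + t ^ 2 := fun e => by ring
    simp only [h2, sum_add_distrib, sum_sub_distrib, ← mul_sum, sum_const, hc, nsmul_eq_mul]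
    ring
  rw [quadForm, sum_congr rfl h, sum_add_distrib, sum_sub_distrib, ← mul_sum, sum_const,
    nsmul_eq_mul, linearForm, quadForm]
  ring

theorem linearForm_sub_const {S : Finset α} {m : ℕ} (hS : #S + m = rk M) (g : α → ℝ) (t : ℝ) :
    linearForm M S (fun e => g e - t) = linearForm M S g - t * (m * #(basesAbove M S)) := by
  rw [← linearForm_one hS]
  simp only [linearForm, sum_sub_distrib, mul_sum, mul_one]

/-- The reverse Cauchy-Schwarz form of negative semidefiniteness on `linearForm M S g = 0`. -/
theorem quadForm_le_of_nonpos {S : Finset α} {m : ℕ} (hS : #S + m = rk M) (hm : 0 < m)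
    (hQ : ∀ g, linearForm M S g = 0 → quadForm M S g ≤ 0) (g : α → ℝ) :
    m * quadForm M S g ≤ (m - 1) * (linearForm M S g ^ 2 / #(basesAbove M S)) := by
  have hm' : (0 : ℝ) < m := by exact_mod_cast hm
  rcases (basesAbove M S).eq_empty_or_nonempty with h | h
  · simp [quadForm, h]
  have hN : (0 : ℝ) < #(basesAbove M S) := by exact_mod_cast card_pos.2 h
  set N : ℝ := (#(basesAbove M S) : ℝ) with hNdef
  set t : ℝ := linearForm M S g / (m * N) with ht
  -- The shift `t` is the average of `g` under the weights of `linearForm`, so it brings `g` into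
  -- the hyperplane.
  have h1 := hQ (fun e => g e - t) (by
    rw [linearForm_sub_const hS, ht]
    field_simp
    ring)
  rw [quadForm_sub_const hS, ← hNdef] at h1
  have h2 : m * (2 * t * (m - 1) * linearForm M S g - t ^ 2 * (m * (m - 1)) * N) =
      (m - 1) * (linearForm M S g ^ 2 / N) := by
    rw [ht]
    field_simp
    ring
  rw [← h2]
  exact mul_le_mul_of_nonneg_left (by linarith) hm'.le

/-! ### Corank two: parallel classes. -/

theorem sum_ite_eq_mul_nonneg {ι κ : Type*} [DecidableEq κ] (X : Finset ι) (K : ι → κ)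
    (g : ι → ℝ) : 0 ≤ ∑ e ∈ X, ∑ f ∈ X, if K e = K f then g e * g f else 0 := by
  have h : ∑ e ∈ X, ∑ f ∈ X, (if K e = K f then g e * g f else 0) =
      ∑ k ∈ X.image K, (∑ e ∈ X with K e = k, g e) ^ 2 := by
    rw [← sum_fiberwise_of_maps_to (g := K) (t := X.image K)
      (fun e he => mem_image_of_mem K he)]
    refine sum_congr rfl fun k _ => ?_
    rw [sq, sum_mul]
    refine sum_congr rfl fun e he => ?_
    rw [mul_sum, sum_filter]
    refine sum_congr rfl fun f _ => ?_
    rw [(mem_filter.1 he).2]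
    simp only [eq_comm]
  rw [h]
  exact sum_nonneg fun k _ => sq_nonneg _

omit [Fintype α] in
/-- If `e`, `h` are not parallel over `S`, then `f` is not parallel to both of them. -/
theorem indep_insert_insert_or {S : Finset α} {e f h : α}
    (hf : M.Indep (insert f S : Finset α)) (hfS : f ∉ S)
    (heh : M.Indep (insert e (insert h S) : Finset α)) (hhS : h ∉ S) (heS : e ∉ S)
    (hne : e ≠ h) :
    (f ≠ e ∧ M.Indep (insert e (insert f S) : Finset α)) ∨
      (f ≠ h ∧ M.Indep (insert h (insert f S) : Finset α)) := by
  obtain ⟨x, hx, hxi⟩ := hf.augment heh (by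
    rw [Set.encard_coe_eq_coe_finsetCard, Set.encard_coe_eq_coe_finsetCard,
      card_insert_of_notMem hfS, card_insert_of_notMem (by simp [hne, heS]),
      card_insert_of_notMem hhS]
    exact_mod_cast Nat.lt_succ_self _)
  rw [← coe_insert] at hxi
  simp only [Set.mem_sdiff, mem_coe, mem_insert, not_or] at hx
  obtain ⟨rfl | rfl | hxS, hxf, hxS'⟩ := hx
  · exact Or.inl ⟨Ne.symm hxf, hxi⟩
  · exact Or.inr ⟨Ne.symm hxf, hxi⟩
  · exact absurd hxS hxS'

-- Two non-loops over `S` span exactly one basis above `S` unless they are parallel. Parallelism is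
-- an equivalence relation, so the form equals the square of the total sum minus the squares of the
-- sums over the classes.
open Classical in
theorem quadForm_le_sq {S : Finset α} (hS : #S + 2 = rk M) (g : α → ℝ) :
    quadForm M S g ≤ (∑ e ∈ Sᶜ with M.Indep (insert e S : Finset α), g e) ^ 2 := by
  set X : Finset α := {e ∈ Sᶜ | M.Indep (insert e S : Finset α)} with hX
  have hmX : ∀ e, e ∈ X ↔ e ∉ S ∧ M.Indep (insert e S : Finset α) := by simp [hX]
  let par : α → α → Prop := fun e f => e = f ∨ ¬ M.Indep (insert e (insert f S) : Finset α)
  have par_symm : ∀ e f, par e f → par f e := by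
    intro e f h
    rcases h with h | h
    · exact Or.inl h.symm
    · exact Or.inr (by rwa [insert_comm])
  have par_trans : ∀ e f h, e ∈ X → f ∈ X → h ∈ X → par e f → par f h → par e h := by
    intro e f h he hf hh hef hfh
    by_contra hcon
    simp only [par, not_or, not_not] at hcon
    rcases indep_insert_insert_or ((hmX f).1 hf).2 ((hmX f).1 hf).1 hcon.2 ((hmX h).1 hh).1
      ((hmX e).1 he).1 hcon.1 with h1 | h1
    · rcases hef with h2 | h2
      · exact h1.1 h2.symm
      · exact h2 h1.2
    · rcases par_symm _ _ hfh with h2 | h2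
      · exact h1.1 h2.symm
      · exact h2 h1.2
  -- The parallel class itself serves as the label of the class.
  let K : α → Finset α := fun e => {f ∈ X | par f e}
  have hK : ∀ e ∈ X, ∀ f ∈ X, K e = K f ↔ par e f := by
    intro e he f hf
    constructor
    · intro h
      have : e ∈ K e := mem_filter.2 ⟨he, Or.inl rfl⟩
      rw [h] at this
      exact (mem_filter.1 this).2
    · intro h
      ext x
      simp only [K, mem_filter]
      refine and_congr_right fun hx => ⟨fun h1 => ?_, fun h1 => ?_⟩
      · exact par_trans x e f hx he hf h1 h
      · exact par_trans x f e hx hf he h1 (par_symm _ _ h)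
  have hcard : ∀ e ∈ X, ∀ f ∈ X, par e f ∨ (e ≠ f ∧ (#(basesAbove M (insert f (insert e S))) : ℝ) = 1) := by
    intro e he f hf
    by_cases h : par e f
    · exact Or.inl h
    refine Or.inr ?_
    simp only [par, not_or, not_not] at h
    refine ⟨h.1, ?_⟩
    rw [insert_comm]
    obtain ⟨B, hB⟩ := (basesAbove_nonempty_iff M).2 h.2
    have : ∀ B' ∈ basesAbove M (insert e (insert f S)), B'.1 = insert e (insert f S) := by
      intro B' hB'
      refine (eq_of_subset_of_card_le ((mem_basesAbove M).1 hB') ?_).symm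
      rw [bases_card, ← hS, card_insert_of_notMem (by simp [h.1, ((hmX e).1 he).1]),
        card_insert_of_notMem ((hmX f).1 hf).1]
    rw [Nat.cast_eq_one, card_eq_one]
    exact ⟨B, eq_singleton_iff_unique_mem.2
      ⟨hB, fun B' hB' => Subtype.ext ((this B' hB').trans (this B hB).symm)⟩⟩
  have hzero : ∀ e, ∀ f, ¬ M.Indep (insert f (insert e S) : Finset α) →
      (#(basesAbove M (insert f (insert e S))) : ℝ) = 0 := by
    intro e f h
    rw [← basesAbove_nonempty_iff, not_nonempty_iff_eq_empty] at h
    simp [h]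
  have hsum : quadForm M S g =
      ∑ e ∈ X, ∑ f ∈ X, (g e * g f - if K e = K f then g e * g f else 0) := by
    rw [quadForm_eq]
    symm
    have hsub : X ⊆ Sᶜ := filter_subset _ _
    refine sum_subset_zero_on_sdiff hsub ?_ ?_
    · intro e he
      have hni : ¬ M.Indep (insert e S : Finset α) := fun h =>
        (mem_sdiff.1 he).2 ((hmX e).2 ⟨mem_compl.1 (mem_sdiff.1 he).1, h⟩)
      rw [← basesAbove_nonempty_iff, not_nonempty_iff_eq_empty] at hni
      simp [linearForm, hni]
    · intro e he
      rw [linearForm_eq, mul_sum]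
      have hsub2 : X.erase e ⊆ (insert e S)ᶜ := by
        intro f hf
        have h1 := mem_erase.1 hf
        simp [h1.1, ((hmX f).1 h1.2).1]
      rw [← add_sum_erase X _ he, if_pos rfl, sub_self, zero_add]
      refine sum_subset_zero_on_sdiff hsub2 ?_ ?_
      · intro f hf
        obtain ⟨h1, h2⟩ := mem_sdiff.1 hf
        simp only [mem_compl, mem_insert, not_or] at h1
        rw [hzero, zero_mul, mul_zero]
        intro h3
        refine h2 (mem_erase.2 ⟨h1.1, (hmX f).2 ⟨h1.2, h3.subset ?_⟩⟩)
        exact_mod_cast insert_subset_insert _ (subset_insert _ _)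
      · intro f hf
        obtain ⟨h1, hfX⟩ := mem_erase.1 hf
        rcases hcard e he f hfX with h | h
        · rw [if_pos ((hK e he f hfX).2 h), hzero]
          · ring
          · rw [insert_comm]
            exact h.resolve_left (Ne.symm h1)
        · have hnp : ¬ par e f := by
            intro hp
            have h0 := hzero e f (by rw [insert_comm]; exact hp.resolve_left h.1)
            rw [h0] at h
            exact zero_ne_one h.2
          rw [if_neg (fun hk => hnp ((hK e he f hfX).1 hk)), h.2]
          ring
  have := sum_ite_eq_mul_nonneg X K g
  rw [hsum]
  simp only [sum_sub_distrib, ← mul_sum, ← sum_mul, sq] at this ⊢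
  linarith

/-! ### Negative semidefiniteness in every corank. -/

/-- The number of bases containing `S`, `e` and `f`, for distinct `e` and `f` outside `S`. -/
noncomputable def pairCount (M : Matroid α) (S : Finset α) : Matrix α α ℝ := fun e f =>
  if e ∈ S then 0 else if f ∈ insert e S then 0 else #(basesAbove M (insert f (insert e S)))

theorem pairCount_symm (S : Finset α) (e f : α) : pairCount M S e f = pairCount M S f e := by
  unfold pairCount
  rw [insert_comm]
  by_cases he : e ∈ S <;> by_cases hf : f ∈ S <;> by_cases hef : e = f <;>
    simp [he, hf, hef, eq_comm]

theorem sum_pairCount_mul (S : Finset α) (g : α → ℝ) (e : α) :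
    ∑ f, pairCount M S e f * g f = if e ∈ S then 0 else linearForm M (insert e S) g := by
  split_ifs with he
  · simp [pairCount, he]
  · rw [linearForm_eq]
    symm
    refine sum_subset_zero_on_sdiff (subset_univ _) ?_ ?_
    · intro f hf
      have : f ∈ insert e S := by simpa [or_iff_not_imp_left] using hf
      simp only [pairCount, if_neg he, if_pos this, zero_mul]
    · intro f hf
      have : f ∉ insert e S := by simpa using hf
      simp only [pairCount, if_neg he, if_neg this]

theorem quadForm_nonpos : ∀ (m : ℕ) (S : Finset α), #S + (m + 2) = rk M →
    ∀ g : α → ℝ, linearForm M S g = 0 → quadForm M S g ≤ 0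
  | 0, S, hS, g, hg => by
    classical
    set X : Finset α := {e ∈ Sᶜ | M.Indep (insert e S : Finset α)} with hX
    -- This shift kills the square in `quadForm_le_sq`. Since `linearForm M S g = 0`, it changes the
    -- form only by a nonnegative multiple of `t ^ 2`.
    set t : ℝ := (∑ e ∈ X, g e) / #X with ht
    have h1 := quadForm_le_sq hS (fun e => g e - t)
    have h2 : ∑ e ∈ X, (g e - t) = 0 := by
      rcases X.eq_empty_or_nonempty with h | h
      · simp [h]
      · have : (#X : ℝ) ≠ 0 := by exact_mod_cast (card_pos.2 h).ne'
        rw [sum_sub_distrib, sum_const, nsmul_eq_mul, ht]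
        field_simp
        ring
    rw [← hX, h2, quadForm_sub_const hS, hg] at h1
    have h3 : (0 : ℝ) ≤ t ^ 2 * (((0 + 2 : ℕ) : ℝ) * (((0 + 2 : ℕ) : ℝ) - 1)) *
        #(basesAbove M S) := by
      norm_num; positivity
    linarith
  | m + 1, S, hS, g, hg => by
    have hSi : ∀ e ∉ S, #(insert e S) + (m + 2) = rk M := fun e he => by
      rw [card_insert_of_notMem he]; omega
    have hform : ∀ g : α → ℝ,
        ∑ e, g e * ∑ f, pairCount M S e f * g f = quadForm M S g := by
      intro g
      rw [quadForm_eq]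
      symm
      refine sum_subset_zero_on_sdiff (subset_univ _) ?_ ?_
      · intro e he
        rw [sum_pairCount_mul, if_pos (by simpa using he), mul_zero]
      · intro e he
        rw [sum_pairCount_mul, if_neg (mem_compl.1 he)]
    rw [← hform]
    refine quadraticForm_nonpos_of_trickle_down (pairCount M S)
      (fun e => if e ∈ S then 0 else #(basesAbove M (insert e S))) (m + 2) ?_
      (pairCount_symm S) ?_ ?_ ?_ ?_ g ?_
    · intro e f
      unfold pairCount
      split_ifs <;> positivity
    · intro e
      split_ifs <;> positivity
    · intro e
      have h := sum_pairCount_mul (M := M) S (fun _ => 1) e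
      simp only [mul_one] at h
      rw [h]
      split_ifs with he
      · simp
      · rw [linearForm_one (hSi e he)]
        push_cast
        ring
    · intro g
      rw [hform]
      -- Local inequality: sum over `e` the reverse Cauchy-Schwarz bounds for `insert e S`, known by
      -- induction; a common factor `m + 1` cancels.
      have h1 := sum_quadForm_insert (m := m + 1) hS g
      have h2 : ∑ e, (∑ f, pairCount M S e f * g f) ^ 2 /
          (if e ∈ S then 0 else (#(basesAbove M (insert e S)) : ℝ)) =
          ∑ e ∈ Sᶜ, linearForm M (insert e S) g ^ 2 / #(basesAbove M (insert e S)) := by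
        symm
        refine sum_subset_zero_on_sdiff (subset_univ _) ?_ ?_
        · intro e he
          rw [if_pos (by simpa using he), div_zero]
        · intro e he
          rw [sum_pairCount_mul, if_neg (mem_compl.1 he), if_neg (mem_compl.1 he)]
      rw [h2]
      have h3 : (m + 2 : ℝ) * ∑ e ∈ Sᶜ, quadForm M (insert e S) g ≤ (m + 1) *
          ∑ e ∈ Sᶜ, linearForm M (insert e S) g ^ 2 / #(basesAbove M (insert e S)) := by
        rw [mul_sum, mul_sum]
        refine sum_le_sum fun e he => ?_
        have he := hSi e (mem_compl.1 he)
        have h := quadForm_le_of_nonpos he (by omega) (quadForm_nonpos m _ he) g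
        push_cast at h
        calc _ ≤ _ := h
          _ = _ := by ring
      rw [h1] at h3
      have hm : (0 : ℝ) < m + 1 := by positivity
      push_cast at h3
      refine le_of_mul_le_mul_left ?_ hm
      linarith
    · intro x hx e f he hf
      have hdef : ∀ {e}, 0 < (if e ∈ S then 0 else (#(basesAbove M (insert e S)) : ℝ)) →
          e ∉ S ∧ M.Indep (insert e S : Finset α) := by
        intro e h
        split_ifs at h with h1
        · exact absurd h (lt_irrefl _)
        · exact ⟨h1, (card_basesAbove_pos_iff M).1 h⟩
      have hedge : ∀ {e f}, e ∉ S → f ∉ S → e ≠ f →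
          M.Indep (insert f (insert e S) : Finset α) → x e = x f := by
        intro e f h1 h2 h3 h4
        refine hx e f ?_
        rw [pairCount, if_neg h1, if_neg (by simp [h2, Ne.symm h3])]
        exact (card_basesAbove_pos_iff M).2 h4
      obtain ⟨heS, hei⟩ := hdef he
      obtain ⟨hfS, hfi⟩ := hdef hf
      -- Connectedness: `e` has a neighbour `h`, and by augmentation every non-loop `f` is a
      -- neighbour of `e` or of `h`.
      obtain ⟨B, hB⟩ := (basesAbove_nonempty_iff M).2 hei
      obtain ⟨h, hh⟩ : (B.1 \ insert e S).Nonempty := by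
        rw [← card_pos, card_sdiff_of_mem_basesAbove (hSi e heS) hB]
        omega
      obtain ⟨hhB, hhe⟩ := mem_sdiff.1 hh
      simp only [mem_insert, not_or] at hhe
      have hhi : M.Indep (insert h (insert e S) : Finset α) := by
        refine B.2.indep.subset ?_
        exact_mod_cast insert_subset hhB ((mem_basesAbove M).1 hB)
      have hxh := hedge heS hhe.2 (Ne.symm hhe.1) hhi
      rcases indep_insert_insert_or hfi hfS hhi heS hhe.2 hhe.1 with h1 | h1
      · rw [hxh]
        exact (hedge hfS hhe.2 h1.1 h1.2).symm
      · exact (hedge hfS heS h1.1 h1.2).symm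
    · rw [linearForm_eq] at hg
      refine Eq.trans (Eq.symm ?_) hg
      refine sum_subset_zero_on_sdiff (subset_univ _) ?_ ?_
      · intro e he
        rw [if_pos (by simpa using he), zero_mul]
      · intro e he
        rw [if_neg (mem_compl.1 he)]

/-! ### Variances and the Poincaré inequality. -/

variable (M)

/-- The average of `f` over the bases containing `S`. -/
noncomputable def meanAbove (S : Finset α) (f : Bases M → ℝ) : ℝ :=
  (∑ B ∈ basesAbove M S, f B) / #(basesAbove M S)

/-- The number of bases containing `S` times the variance of `f` over these bases. -/
noncomputable def varianceAbove (S : Finset α) (f : Bases M → ℝ) : ℝ :=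
  ∑ B ∈ basesAbove M S, (f B - meanAbove M S f) ^ 2

/-- The sets that contain `S` and have one element less than a basis. -/
noncomputable def facetsAbove (S : Finset α) : Finset (Finset α) := {T | S ⊆ T ∧ #T + 1 = rk M}

theorem mem_facetsAbove {S T : Finset α} :
    T ∈ facetsAbove M S ↔ S ⊆ T ∧ #T + 1 = rk M := by
  simp [facetsAbove]

theorem card_mul_meanAbove (S : Finset α) (f : Bases M → ℝ) :
    #(basesAbove M S) * meanAbove M S f = ∑ B ∈ basesAbove M S, f B := by
  rcases (basesAbove M S).eq_empty_or_nonempty with h | h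
  · simp [h]
  · have : (#(basesAbove M S) : ℝ) ≠ 0 := by exact_mod_cast (card_pos.2 h).ne'
    rw [meanAbove]
    field_simp

theorem varianceAbove_eq (S : Finset α) (f : Bases M → ℝ) (c : ℝ) :
    varianceAbove M S f = ∑ B ∈ basesAbove M S, (f B - c) ^ 2 -
      #(basesAbove M S) * (meanAbove M S f - c) ^ 2 := by
  have h : ∀ B, (f B - meanAbove M S f) ^ 2 = (f B - c) ^ 2 -
      2 * (meanAbove M S f - c) * f B + (meanAbove M S f ^ 2 - c ^ 2) := fun B => by ring
  rw [varianceAbove, sum_congr rfl fun B _ => h B, sum_add_distrib, sum_sub_distrib, ← mul_sum,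
    ← card_mul_meanAbove M S f, sum_const, nsmul_eq_mul]
  ring

theorem varianceAbove_nonneg (S : Finset α) (f : Bases M → ℝ) : 0 ≤ varianceAbove M S f :=
  sum_nonneg fun _ _ => sq_nonneg _

variable {M}

/-- By the law of total variance the right side is `(m + 2) * varianceAbove M S f - X`, where `X` is
the weighted sum of squares of the deviations `g e` of the conditional means. It remains to see `X ≤
varianceAbove M S f`. -/
theorem mul_varianceAbove_le_sum_insert {S : Finset α} {m : ℕ} (hS : #S + (m + 2) = rk M)
    (f : Bases M → ℝ) :
    (m + 1) * varianceAbove M S f ≤ ∑ e ∈ Sᶜ, varianceAbove M (insert e S) f := by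
  set μ := meanAbove M S f with hμ
  set g : α → ℝ := fun e => meanAbove M (insert e S) f - μ with hg
  have hcg : ∀ e, #(basesAbove M (insert e S)) * g e =
      ∑ B ∈ basesAbove M (insert e S), (f B - μ) := by
    intro e
    rw [hg, mul_sub, card_mul_meanAbove, sum_sub_distrib, sum_const, nsmul_eq_mul]
  set X : ℝ := ∑ B ∈ basesAbove M S, ∑ e ∈ B.1 \ S, g e ^ 2 with hX
  have hX1 : ∑ e ∈ Sᶜ, #(basesAbove M (insert e S)) * g e ^ 2 = X := by
    rw [hX, ← sum_basesAbove_insert]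
    simp
  have hX2 : ∑ B ∈ basesAbove M S, (f B - μ) * ∑ e ∈ B.1 \ S, g e = X := by
    simp only [mul_sum]
    rw [← sum_basesAbove_insert, ← hX1]
    refine sum_congr rfl fun e _ => ?_
    rw [← sum_mul, ← hcg]
    ring
  have hV : ∑ e ∈ Sᶜ, varianceAbove M (insert e S) f = (m + 2) * varianceAbove M S f - X := by
    simp only [varianceAbove_eq M (insert _ S) f μ]
    rw [sum_sub_distrib, hX1, sum_basesAbove_insert, varianceAbove, mul_sum]
    congr 1
    refine sum_congr rfl fun B hB => ?_
    rw [sum_const, card_sdiff_of_mem_basesAbove hS hB, nsmul_eq_mul]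
    push_cast
    rfl
  have hL : linearForm M S g = 0 := by
    rw [linearForm_eq, sum_congr rfl fun e _ => hcg e, sum_basesAbove_insert]
    have h : ∀ B ∈ basesAbove M S, ∑ e ∈ B.1 \ S, (f B - μ) = (m + 2) * (f B - μ) := by
      intro B hB
      rw [sum_const, card_sdiff_of_mem_basesAbove hS hB, nsmul_eq_mul]
      push_cast
      rfl
    rw [sum_congr rfl h, ← mul_sum, sum_sub_distrib, ← card_mul_meanAbove, sum_const,
      nsmul_eq_mul, hμ, sub_self, mul_zero]
  have hQ := quadForm_nonpos m S hS g hL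
  rw [quadForm, sum_sub_distrib, ← hX] at hQ
  -- The cross term is `-2 * X`, and `quadForm_nonpos` bounds the last square by `X`; together they
  -- leave `0 ≤ varianceAbove M S f - X`.
  have hsq : 0 ≤ ∑ B ∈ basesAbove M S, ((f B - μ) - ∑ e ∈ B.1 \ S, g e) ^ 2 :=
    sum_nonneg fun _ _ => sq_nonneg _
  have hexp : ∑ B ∈ basesAbove M S, ((f B - μ) - ∑ e ∈ B.1 \ S, g e) ^ 2 =
      varianceAbove M S f - 2 * X + ∑ B ∈ basesAbove M S, (∑ e ∈ B.1 \ S, g e) ^ 2 := by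
    simp only [sub_sq, sum_add_distrib, sum_sub_distrib, mul_assoc, ← mul_sum]
    rw [hX2, varianceAbove]
    simp only [sub_sq, sum_add_distrib, sum_sub_distrib, mul_assoc, ← mul_sum, hμ]
  rw [hV]
  linarith

/-- The Poincaré inequality for the bases containing `S`. -/
theorem varianceAbove_le_sum_facetsAbove : ∀ (m : ℕ) (S : Finset α), #S + (m + 1) = rk M →
    ∀ f : Bases M → ℝ, varianceAbove M S f ≤ ∑ T ∈ facetsAbove M S, varianceAbove M T f
  | 0, S, hS, f => by
    exact single_le_sum (f := fun T => varianceAbove M T f)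
      (fun T _ => varianceAbove_nonneg M T f) ((mem_facetsAbove M).2 ⟨Subset.rfl, hS⟩)
  | m + 1, S, hS, f => by
    have h1 : ∑ e ∈ Sᶜ, varianceAbove M (insert e S) f ≤
        ∑ e ∈ Sᶜ, ∑ T ∈ facetsAbove M (insert e S), varianceAbove M T f := by
      refine sum_le_sum fun e he => varianceAbove_le_sum_facetsAbove m _ ?_ f
      rw [card_insert_of_notMem (mem_compl.1 he)]
      omega
    have h2 : ∑ e ∈ Sᶜ, ∑ T ∈ facetsAbove M (insert e S), varianceAbove M T f =
        ∑ T ∈ facetsAbove M S, ∑ e ∈ T \ S, varianceAbove M T f := by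
      refine sum_comm' fun e T => ?_
      simp only [mem_facetsAbove, insert_subset_iff, mem_compl, mem_sdiff]
      tauto
    -- Each facet is reached through each of its `m + 1` elements outside `S`, which matches the
    -- factor of the one-element step.
    have h3 : ∀ T ∈ facetsAbove M S, ∑ e ∈ T \ S, varianceAbove M T f =
        (m + 1) * varianceAbove M T f := by
      intro T hT
      obtain ⟨hST, hTc⟩ := (mem_facetsAbove M).1 hT
      have : #(T \ S) = m + 1 := by
        rw [card_sdiff_of_subset hST]
        omega
      rw [sum_const, this, nsmul_eq_mul]
      push_cast
      rfl
    rw [h2, sum_congr rfl h3, ← mul_sum] at h1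
    have h4 := (mul_varianceAbove_le_sum_insert (m := m) hS f).trans h1
    exact le_of_mul_le_mul_left h4 (by positivity)

/-! ### The walk as averaging over facets, and its spectral gap. -/

theorem sum_basesAbove_erase (φ : Finset α → Bases M → ℝ) :
    ∑ B : Bases M, ∑ e ∈ B.1, φ (B.1.erase e) B =
      ∑ T ∈ facetsAbove M ∅, ∑ B ∈ basesAbove M T, φ T B := by
  have h : ∀ B : Bases M, ∑ e ∈ B.1, φ (B.1.erase e) B =
      ∑ T ∈ facetsAbove M ∅ with T ⊆ B.1, φ T B := by
    intro B
    have hB := bases_card M B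
    refine sum_bij (fun e _ => B.1.erase e) ?_ ?_ ?_ ?_
    · intro e he
      rw [mem_filter, mem_facetsAbove, card_erase_add_one he]
      exact ⟨⟨empty_subset _, hB⟩, erase_subset _ _⟩
    · intro a ha b hb h
      by_contra hab
      have : a ∈ B.1.erase b := mem_erase.2 ⟨hab, ha⟩
      rw [← h] at this
      simp at this
    · intro T hT
      rw [mem_filter, mem_facetsAbove] at hT
      have hd : #(B.1 \ T) = 1 := by
        rw [card_sdiff_of_subset hT.2]; omega
      obtain ⟨g, hg⟩ := card_eq_one.1 hd
      have hgB : g ∈ B.1 \ T := by rw [hg]; simp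
      refine ⟨g, (mem_sdiff.1 hgB).1, ?_⟩
      rw [← sdiff_singleton_eq_erase, ← hg, Finset.sdiff_sdiff_eq_self hT.2]
    · intro _ _
      rfl
  rw [sum_congr rfl fun B _ => h B]
  refine sum_comm' fun B T => ?_
  simp [mem_basesAbove, and_comm]

theorem sum_extensions_ite {T : Finset α} (hT : #T + 1 = rk M) (B : Bases M) :
    ∑ f ∈ extensions M T, (if B.1 = insert f T then (1 : ℝ) else 0) =
      if T ⊆ B.1 then 1 else 0 := by
  split_ifs with hs
  · have hd : #(B.1 \ T) = 1 := by
      rw [card_sdiff_of_subset hs, bases_card]; omega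
    obtain ⟨g, hg⟩ := card_eq_one.1 hd
    have hY : B.1 = insert g T := by
      rw [← sdiff_union_of_subset hs, hg]; rfl
    have hgm : g ∉ T := by
      have : g ∈ B.1 \ T := by rw [hg]; simp
      exact (mem_sdiff.1 this).2
    rw [sum_eq_single g]
    · simp [← hY]
    · intro f _ hfg
      rw [if_neg]
      intro h
      have : g ∈ insert f T := by rw [← h, hY]; simp
      rcases mem_insert.1 this with h | h
      · exact hfg h.symm
      · exact hgm h
    · intro h
      exact absurd ((mem_extensions M _ g).2 (by rw [← hY]; exact B.2)) h
  · refine sum_eq_zero fun f _ => ?_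
    rw [if_neg]
    intro h
    exact hs (by rw [h]; exact subset_insert _ _)

theorem card_extensions {T : Finset α} (hT : #T + 1 = rk M) :
    (#(extensions M T) : ℝ) = #(basesAbove M T) := by
  have h1 : ∑ B : Bases M, ∑ f ∈ extensions M T, (if B.1 = insert f T then (1 : ℝ) else 0) =
      #(basesAbove M T) := by
    rw [sum_congr rfl fun B _ => sum_extensions_ite hT B, ← sum_filter]
    simp [basesAbove]
  rw [← h1, sum_comm, card_eq_sum_ones]
  push_cast
  refine sum_congr rfl fun f hf => ?_
  rw [sum_eq_single (⟨_, (mem_extensions M _ f).1 hf⟩ : Bases M)]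
  · simp
  · intro b _ hb
    rw [if_neg]
    intro h
    exact hb (Subtype.ext h)
  · simp

theorem walk_mulVec (hr : rk M ≠ 0) (f : Bases M → ℝ) (B : Bases M) :
    ∑ B', walk M B B' * f B' = (1 / (rk M : ℝ)) * ∑ e ∈ B.1, meanAbove M (B.1.erase e) f := by
  have hB : B.1 ≠ ∅ := by
    intro h
    exact hr (by rw [← bases_card M B, h, card_empty])
  have h1 : ∀ B', walk M B B' = (1 / (rk M : ℝ)) * ∑ e ∈ B.1,
      (1 / (#(basesAbove M (B.1.erase e)) : ℝ)) * if B.1.erase e ⊆ B'.1 then 1 else 0 := by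
    intro B'
    rw [walk, if_neg hB, ← mul_sum, bases_card]
    congr 1
    refine sum_congr rfl fun e he => ?_
    have hT : #(B.1.erase e) + 1 = rk M := by rw [card_erase_add_one he, bases_card]
    rw [← mul_sum, sum_extensions_ite hT, card_extensions hT]
  simp only [h1, mul_assoc, ← mul_sum, sum_mul]
  rw [sum_comm]
  congr 1
  refine sum_congr rfl fun e _ => ?_
  simp only [← mul_sum, meanAbove, basesAbove, sum_filter, ite_mul, one_mul, zero_mul]
  ring

theorem sum_mul_walk_mulVec (hr : rk M ≠ 0) (f : Bases M → ℝ) :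
    rk M * ∑ B, f B * ∑ B', walk M B B' * f B' =
      ∑ T ∈ facetsAbove M ∅, #(basesAbove M T) * meanAbove M T f ^ 2 := by
  have hr' : (rk M : ℝ) ≠ 0 := by exact_mod_cast hr
  have h := sum_basesAbove_erase (M := M) (fun T B => f B * meanAbove M T f)
  simp only [← sum_mul, ← mul_sum] at h
  rw [mul_sum]
  calc _ = ∑ B : Bases M, f B * ∑ e ∈ B.1, meanAbove M (B.1.erase e) f := by
        refine sum_congr rfl fun B _ => ?_
        rw [walk_mulVec hr]
        field_simp
    _ = _ := h
    _ = _ := by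
        refine sum_congr rfl fun T _ => ?_
        rw [← card_mul_meanAbove]
        ring

theorem sum_mul_walk_mulVec_nonneg (hr : rk M ≠ 0) (f : Bases M → ℝ) :
    0 ≤ ∑ B, f B * ∑ B', walk M B B' * f B' := by
  have hr' : (0 : ℝ) < rk M := by exact_mod_cast Nat.pos_of_ne_zero hr
  refine nonneg_of_mul_nonneg_right ?_ hr'
  rw [sum_mul_walk_mulVec hr]
  positivity

/-- The spectral gap of the bases-exchange walk is at least the inverse of the rank. -/
theorem sum_mul_walk_mulVec_le (hr : rk M ≠ 0) (f : Bases M → ℝ) (hf : ∑ B, f B = 0) :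
    ∑ B, f B * ∑ B', walk M B B' * f B' ≤ (1 - 1 / (rk M : ℝ)) * ∑ B, f B ^ 2 := by
  have hr' : (0 : ℝ) < rk M := by exact_mod_cast Nat.pos_of_ne_zero hr
  have hP := varianceAbove_le_sum_facetsAbove (M := M) (rk M - 1) ∅ (by simp; omega) f
  have huniv : basesAbove M ∅ = univ := by
    ext B
    simp [mem_basesAbove]
  have hV : varianceAbove M ∅ f = ∑ B, f B ^ 2 := by
    simp [varianceAbove, meanAbove, huniv, hf]
  have hF := sum_basesAbove_erase (M := M) (fun _ B => f B ^ 2)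
  have hF1 : ∀ B : Bases M, ∑ _e ∈ B.1, f B ^ 2 = rk M * f B ^ 2 := by
    intro B
    rw [sum_const, bases_card, nsmul_eq_mul]
  rw [sum_congr rfl fun B _ => hF1 B, ← mul_sum] at hF
  have h0 : ∑ T ∈ facetsAbove M ∅, varianceAbove M T f =
      rk M * ∑ B, f B ^ 2 - rk M * ∑ B, f B * ∑ B', walk M B B' * f B' := by
    rw [sum_mul_walk_mulVec hr, hF, ← sum_sub_distrib]
    refine sum_congr rfl fun T _ => ?_
    rw [varianceAbove_eq M T f 0]
    simp
  rw [hV, h0] at hP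
  refine le_of_mul_le_mul_left ?_ hr'
  have : rk M * ((1 - 1 / (rk M : ℝ)) * ∑ B, f B ^ 2) =
      rk M * ∑ B, f B ^ 2 - ∑ B, f B ^ 2 := by
    field_simp
  linarith

/-! ### From the gap to total variation distance. -/

/-- A symmetric positive semidefinite matrix `P` with row sums one whose Rayleigh quotients on
mean-zero functions are at most `c` contracts such functions by the factor `c`. -/
theorem sum_sq_pow_mulVec_le {Ω : Type*} [Fintype Ω] [DecidableEq Ω] (P : Matrix Ω Ω ℝ)
    (hsymm : ∀ x y, P x y = P y x) (hrow : ∀ x, ∑ y, P x y = 1) {c : ℝ} (hc : 0 < c)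
    (hpos : ∀ f : Ω → ℝ, 0 ≤ f ⬝ᵥ P.mulVec f)
    (hle : ∀ f : Ω → ℝ, ∑ x, f x = 0 → f ⬝ᵥ P.mulVec f ≤ c * (f ⬝ᵥ f))
    (f : Ω → ℝ) (hf : ∑ x, f x = 0) (t : ℕ) :
    (∑ x, (P ^ t).mulVec f x = 0) ∧
      (P ^ t).mulVec f ⬝ᵥ (P ^ t).mulVec f ≤ (c ^ t) ^ 2 * (f ⬝ᵥ f) := by
  induction t with
  | zero => simp [hf]
  | succ t ih =>
    obtain ⟨h0, h1⟩ := ih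
    set g := (P ^ t).mulVec f with hg
    have hstep : (P ^ (t + 1)).mulVec f = P.mulVec g := by
      rw [hg, Matrix.mulVec_mulVec, pow_succ']
    rw [hstep]
    have hz : ∑ x, P.mulVec g x = 0 := by
      simp only [Matrix.mulVec, dotProduct]
      rw [sum_comm]
      calc _ = ∑ y, (∑ x, P y x) * g y := by
            refine sum_congr rfl fun y _ => ?_
            rw [sum_mul]
            exact sum_congr rfl fun x _ => by rw [hsymm]
        _ = 0 := by simp [hrow, h0]
    refine ⟨hz, ?_⟩
    have hadj : g ⬝ᵥ P.mulVec (P.mulVec g) = P.mulVec g ⬝ᵥ P.mulVec g := by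
      rw [Matrix.dotProduct_mulVec, ← Matrix.mulVec_transpose]
      congr 2
      ext x y
      exact hsymm y x
    -- Positivity at this vector, with the Rayleigh bounds at `g` and `P g`, yields `‖P g‖² ≤ c²
    -- ‖g‖²` without diagonalizing `P`.
    have h2 := hpos (g - c⁻¹ • P.mulVec g)
    simp only [Matrix.mulVec_sub, Matrix.mulVec_smul, sub_dotProduct, dotProduct_sub,
      smul_dotProduct, dotProduct_smul, smul_eq_mul, hadj] at h2
    have h3 := hle g h0
    have h4 := hle _ hz
    set a := g ⬝ᵥ g
    set b := P.mulVec g ⬝ᵥ P.mulVec g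
    set p := g ⬝ᵥ P.mulVec g
    set q := P.mulVec g ⬝ᵥ P.mulVec (P.mulVec g)
    have h5 : c⁻¹ * (c⁻¹ * q) ≤ c⁻¹ * b := by
      have : c⁻¹ * (c⁻¹ * q) ≤ c⁻¹ * (c⁻¹ * (c * b)) := by gcongr
      rwa [inv_mul_cancel_left₀ hc.ne'] at this
    have h6 : c⁻¹ * b ≤ c * a := by linarith
    have h7 : b ≤ c ^ 2 * a := by
      have := mul_le_mul_of_nonneg_left h6 hc.le
      rw [mul_inv_cancel_left₀ hc.ne'] at this
      linarith
    calc b ≤ c ^ 2 * a := h7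
      _ ≤ c ^ 2 * ((c ^ t) ^ 2 * (f ⬝ᵥ f)) := by gcongr
      _ = _ := by ring

theorem tvDist_le_sqrt {Ω : Type*} [Fintype Ω] (μ ν : Ω → ℝ) :
    tvDist μ ν ≤ 1 / 2 * √(Fintype.card Ω * ∑ x, (μ x - ν x) ^ 2) := by
  unfold tvDist
  gcongr
  refine Real.le_sqrt_of_sq_le ?_
  have := sq_sum_le_card_mul_sum_sq (s := (univ : Finset Ω)) (f := fun x => |μ x - ν x|)
  simpa using this

theorem tvDist_walk_pow_le (hr : rk M ≠ 0) (B : Bases M) (t : ℕ) :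
    tvDist ((walk M ^ t) B) (uniform (Bases M)) ≤
      1 / 2 * √(Fintype.card (Bases M)) * Real.exp (-(t / rk M)) := by
  have hN : (0 : ℝ) < Fintype.card (Bases M) := by
    exact_mod_cast Fintype.card_pos_iff.2 ⟨B⟩
  have hr' : (0 : ℝ) < rk M := by exact_mod_cast Nat.pos_of_ne_zero hr
  set f : Bases M → ℝ := fun x => (if x = B then 1 else 0) - 1 / (Fintype.card (Bases M) : ℝ)
    with hf
  have hf0 : ∑ x, f x = 0 := by
    simp only [hf, sum_sub_distrib, sum_ite_eq', mem_univ, if_true, sum_const, card_univ,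
      nsmul_eq_mul]
    field_simp
    ring
  have hf1 : f ⬝ᵥ f ≤ 1 := by
    have : f ⬝ᵥ f = 1 - 1 / (Fintype.card (Bases M) : ℝ) := by
      have h : ∀ x, f x * f x = (if x = B then 1 else 0) *
          (1 - 2 * (1 / (Fintype.card (Bases M) : ℝ))) +
          1 / (Fintype.card (Bases M) : ℝ) * (1 / (Fintype.card (Bases M) : ℝ)) := by
        intro x
        simp only [hf]
        split_ifs <;> ring
      simp only [dotProduct, h, sum_add_distrib, ← sum_mul, sum_ite_eq', mem_univ, if_true,
        sum_const, card_univ, nsmul_eq_mul]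
      field_simp
      ring
    rw [this]
    linarith [one_div_pos.2 hN]
  have hsymm := walk_symm M
  have hT : (walk M ^ t).transpose = walk M ^ t := by
    rw [Matrix.transpose_pow]
    congr 1
    ext x y
    exact hsymm y x
  have hrowt : (walk M ^ t).mulVec (fun _ => 1) = fun _ => 1 := by
    induction t with
    | zero => simp
    | succ t ih =>
      have h1 : (walk M).mulVec (fun _ => 1) = fun _ => 1 := by
        ext x
        simp [Matrix.mulVec, dotProduct, walk_row_sum]
      rw [pow_succ', ← Matrix.mulVec_mulVec, ih (by
        rw [Matrix.transpose_pow]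
        congr 1
        ext x y
        exact hsymm y x), h1]
  have hPf : ∀ x, (walk M ^ t) B x - uniform (Bases M) x = (walk M ^ t).mulVec f x := by
    intro x
    have h1 : ∑ y, (walk M ^ t) x y = 1 := by
      simpa [Matrix.mulVec, dotProduct] using congrFun hrowt x
    have h2 : (walk M ^ t) B x = (walk M ^ t) x B := by
      conv_lhs => rw [← hT]
      rfl
    simp only [Matrix.mulVec, dotProduct, hf, mul_sub, sum_sub_distrib, ← sum_mul, h1, uniform,
      h2, mul_ite, mul_one, mul_zero, sum_ite_eq', mem_univ, if_true, one_mul]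
  -- The factor `exp (-1 / r)` dominates `1 - 1 / r` and stays positive when `r = 1`.
  have hbound := (sum_sq_pow_mulVec_le (walk M) hsymm (walk_row_sum M)
    (Real.exp_pos (-(1 / (rk M : ℝ)))) (sum_mul_walk_mulVec_nonneg hr) (fun f hf => by
      refine (sum_mul_walk_mulVec_le hr f hf).trans ?_
      have h1 : ∑ B, f B ^ 2 = f ⬝ᵥ f := by simp only [dotProduct, sq]
      rw [h1]
      refine mul_le_mul_of_nonneg_right ?_ (by rw [← h1]; positivity)
      linarith [Real.add_one_le_exp (-(1 / (rk M : ℝ)))]) f hf0 t).2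
  have hexp : Real.exp (-(1 / (rk M : ℝ))) ^ t = Real.exp (-(t / rk M)) := by
    rw [← Real.exp_nat_mul]
    congr 1
    ring
  rw [hexp] at hbound
  have hsum : ∑ x, ((walk M ^ t) B x - uniform (Bases M) x) ^ 2 ≤
      Real.exp (-(t / rk M)) ^ 2 := by
    calc _ = (walk M ^ t).mulVec f ⬝ᵥ (walk M ^ t).mulVec f := by
          simp only [hPf, dotProduct, sq]
      _ ≤ _ := hbound
      _ ≤ Real.exp (-(t / rk M)) ^ 2 * 1 := by gcongr
      _ = _ := mul_one _
  refine (tvDist_le_sqrt _ _).trans ?_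
  rw [mul_assoc]
  gcongr
  rw [Real.sqrt_mul hN.le]
  gcongr
  exact (Real.sqrt_le_sqrt hsum).trans_eq (Real.sqrt_sq (Real.exp_pos _).le)

theorem tvDist_walk_pow_le_quarter (hr : rk M ≠ 0) (B : Bases M) (t : ℕ)
    (ht : rk M * (Real.log (Fintype.card (Bases M)) / 2 + Real.log 2) ≤ t) :
    tvDist ((walk M ^ t) B) (uniform (Bases M)) ≤ 1 / 4 := by
  have hN : (0 : ℝ) < Fintype.card (Bases M) := by
    exact_mod_cast Fintype.card_pos_iff.2 ⟨B⟩
  have hr' : (0 : ℝ) < rk M := by exact_mod_cast Nat.pos_of_ne_zero hr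
  refine (tvDist_walk_pow_le hr B t).trans ?_
  have h1 : Real.exp (-(t / rk M)) ≤ (√(Fintype.card (Bases M)) * 2)⁻¹ := by
    have h2 : √(Fintype.card (Bases M)) * 2 =
        Real.exp (Real.log (Fintype.card (Bases M)) / 2 + Real.log 2) := by
      rw [Real.exp_add, Real.exp_log two_pos, ← Real.log_sqrt hN.le,
        Real.exp_log (Real.sqrt_pos.2 hN)]
    rw [h2, ← Real.exp_neg]
    refine Real.exp_le_exp.2 (neg_le_neg ?_)
    rw [le_div_iff₀ hr']
    linarith
  have hs := Real.sqrt_pos.2 hN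
  calc _ ≤ 1 / 2 * √(Fintype.card (Bases M)) * (√(Fintype.card (Bases M)) * 2)⁻¹ := by gcongr
    _ = 1 / 4 := by
      field_simp
      norm_num

/-! ### Counting bases and the final bound. -/

variable (M)

theorem log_card_bases_le :
    Real.log (Fintype.card (Bases M)) ≤ rk M * Real.log (M.E.ncard : ℝ) := by
  obtain ⟨B₀, hB₀⟩ : (basesAbove M ∅).Nonempty :=
    (basesAbove_nonempty_iff M).2 (by simp)
  have hcard : Fintype.card (Bases M) ≤ M.E.ncard ^ rk M := by
    have hinj : Fintype.card (Bases M) ≤ #(powersetCard (rk M) M.E.toFinite.toFinset) := by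
      rw [← card_univ]
      refine card_le_card_of_injOn (fun B => B.1) ?_ Subtype.val_injective.injOn
      intro B _
      rw [mem_coe, mem_powersetCard]
      refine ⟨fun e he => ?_, bases_card M B⟩
      simpa using B.2.subset_ground he
    rw [card_powersetCard, ← Set.ncard_eq_toFinset_card _ M.E.toFinite] at hinj
    exact hinj.trans (Nat.choose_le_pow _ _)
  have hN : (0 : ℝ) < Fintype.card (Bases M) := by
    exact_mod_cast Fintype.card_pos_iff.2 ⟨B₀⟩
  rw [← Real.log_pow]
  exact Real.log_le_log hN (by exact_mod_cast hcard)

theorem exists_mixing_le : ∃ t : ℕ,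
    (∀ B : Bases M, tvDist ((walk M ^ t) B) (uniform (Bases M)) ≤ 1 / 4) ∧
      (t : ℝ) ≤ 3 * (rk M * Real.log (Fintype.card (Bases M))) := by
  have hlog : 0 ≤ Real.log (Fintype.card (Bases M)) := Real.log_natCast_nonneg _
  rcases le_or_gt (Fintype.card (Bases M)) 1 with h | h
  · refine ⟨0, fun B => ?_, by simpa using by positivity⟩
    have := Fintype.card_le_one_iff_subsingleton.1 h
    have hc : Fintype.card (Bases M) = 1 :=
      le_antisymm h (Fintype.card_pos_iff.2 ⟨B⟩)
    have h0 : ∀ x, ((walk M ^ 0) B x) - uniform (Bases M) x = 0 := by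
      intro x
      rw [Subsingleton.elim x B]
      simp [uniform, hc]
    simp only [tvDist, h0]
    norm_num
  · have hr : rk M ≠ 0 := by
      intro h0
      refine absurd (Fintype.card_le_one_iff.2 fun A B => Subtype.ext ?_) (not_le.2 h)
      rw [card_eq_zero.1 ((bases_card M A).trans h0), card_eq_zero.1 ((bases_card M B).trans h0)]
    have hr1 : (1 : ℝ) ≤ rk M := by exact_mod_cast Nat.one_le_iff_ne_zero.2 hr
    have hlog2 : Real.log 2 ≤ Real.log (Fintype.card (Bases M)) :=
      Real.log_le_log two_pos (by exact_mod_cast h)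
    refine ⟨⌈rk M * (Real.log (Fintype.card (Bases M)) / 2 + Real.log 2)⌉₊, fun B =>
      tvDist_walk_pow_le_quarter hr B _ (Nat.le_ceil _), ?_⟩
    -- The constant 3 is `1/2 + 1 + 3/2`: the main term, `log 2 ≤ log |F|`, and the rounding error
    -- `1 ≤ (3/2) * log 2`.
    have hpos2 := Real.log_two_gt_d9
    refine (Nat.ceil_lt_add_one (by positivity)).le.trans ?_
    have h1 : (rk M : ℝ) * Real.log 2 ≤ rk M * Real.log (Fintype.card (Bases M)) := by gcongr
    have h2 : 1 * Real.log 2 ≤ rk M * Real.log 2 := by gcongr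
    linarith

end BasesExchange

theorem mainTheorem7 :
    ∃ C : ℝ, 0 < C ∧
      ∀ (α : Type*) [Fintype α] [DecidableEq α] (M : Matroid α),
        ∃ T : ℕ,
          BasesExchange.IsMixingTime (BasesExchange.walk M)
            (BasesExchange.uniform (BasesExchange.Bases M)) (1 / 4) T ∧
          (T : ℝ) ≤ C * ((BasesExchange.rk M : ℝ) *
            Real.log (Fintype.card (BasesExchange.Bases M) : ℝ)) ∧
          C * ((BasesExchange.rk M : ℝ) *
              Real.log (Fintype.card (BasesExchange.Bases M) : ℝ)) ≤
            C * ((BasesExchange.rk M : ℝ) ^ 2 * Real.log (M.E.ncard : ℝ)) := by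
  refine ⟨3, by norm_num, fun α _ _ M => ?_⟩
  obtain ⟨t, ht, hle⟩ := BasesExchange.exists_mixing_le M
  set A : Set ℕ := {t : ℕ | ∀ x : BasesExchange.Bases M,
    BasesExchange.tvDist ((BasesExchange.walk M ^ t) x)
      (BasesExchange.uniform (BasesExchange.Bases M)) ≤ 1 / 4} with hA
  have htA : t ∈ A := ht
  refine ⟨sInf A, ⟨Nat.sInf_mem ⟨t, htA⟩, fun s hs => Nat.sInf_le hs⟩, ?_, ?_⟩
  · exact le_trans (by exact_mod_cast Nat.sInf_le htA) hle
  · have h := BasesExchange.log_card_bases_le M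
    rw [sq, mul_assoc]
    gcongr
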